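/- Let $K$ be a (commutative) field, and let $L$ be an infinite (commutative) field with $\operatorname{char} L\neq\operatorname{char} K$. Let $\mathcal A$ be an additive category which is $L$-linear, i.e. its Hom-groups are $L$-vector spaces and composition is $L$-bilinear. Let $\mathcal F^{df}(\mathcal A;K)$ be the full subcategory of the category of all (not necessarily additive) functors from $\mathcal A$ to $K$-vector spaces consisting of those functors $F$ such that $F(x)$ is finite-dimensional over $K$ for every object $x$ of $\mathcal A$. Then $\mathcal F^{df}(\mathcal A;K)$ consists exactly of the constant functors with finite-dimensional value: a functor $F$ from $\mathcal A$ to $K$-vector spaces belongs to $\mathcal F^{df}(\mathcal A;K)$ if and only if there is a finite-dimensional $K$-vector space $V$ such that $F$ is isomorphic to the functor sending every object to $V$ and every morphism to $\mathrm{id}_V$. -/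

import Mathlib

open CategoryTheory CategoryTheory.Limits

universe w k v u

/-- The functors from `C` to `K`-vector spaces all of whose values are finite-dimensional over `K`:
the objects of the full subcategory `𝓕^df(C; K)` of `𝓕(C; K)`. -/
def finDimValued (C : Type u) [Category.{v} C] (K : Type k) [Field K] :
    ObjectProperty (C ⥤ ModuleCat.{w} K) :=
  fun F => ∀ x : C, FiniteDimensional K (F.obj x)

/-- `F` is constant with value `V`, up to natural isomorphism. -/
def IsConstantWithValue {C : Type u} [Category.{v} C] {K : Type k} [Field K]
    (F : C ⥤ ModuleCat.{w} K) (V : ModuleCat.{w} K) : Prop :=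
  Nonempty (F ≅ (Functor.const C).obj V)

/-! It suffices that `F` sends `0 : x ⟶ x` to the identity: zero maps then identify `F x` with `F
0`. Transvections represent the additive group of `L` on `F (x ⊞ x)`, and diagonal scalings
conjugate this representation to its twists by `Lˣ`. Its finite-dimensional commutative image
algebra has finitely many characters and `Lˣ` is infinite, so every character is trivial on `L` and
the representation is unipotent. Differing characteristics then make it trivial. -/

/-- In a finite-dimensional commutative `K`-algebra, an element killed by all characters with
values in the algebraic closure is nilpotent. -/
theorem isNilpotent_of_forall_algHom_algebraicClosure {K B : Type*} [Field K] [CommRing B]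
    [Algebra K B] [FiniteDimensional K B] {b : B}
    (h : ∀ ψ : B →ₐ[K] AlgebraicClosure K, ψ b = 0) : IsNilpotent b := by
  have : IsArtinianRing B := IsArtinianRing.of_finite K B
  rw [nilpotent_iff_mem_prime]
  intro P hP
  have : P.IsMaximal := Ideal.IsPrime.isMaximal' hP
  let : Field (B ⧸ P) := Ideal.Quotient.field P
  let φ : B ⧸ P →ₐ[K] AlgebraicClosure K := IsAlgClosed.lift
  have hφ := h (φ.comp (Ideal.Quotient.mkₐ K P))
  rw [← Ideal.Quotient.eq_zero_iff_mem]
  exact φ.injective (by simpa using hφ)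

/-- If an additive family `U` in a finite-dimensional commutative algebra is permuted, up to
algebra endomorphisms, by the scalings of the infinite field indexing it, then it is unipotent. -/
theorem isNilpotent_sub_one_of_scaling {K L B : Type*} [Field K] [Field L] [Infinite L]
    [CommRing B] [Algebra K B] [FiniteDimensional K B] (U : Multiplicative L →* B)
    (c : Lˣ → B →ₐ[K] B) (hc : ∀ l a, c l (U (.ofAdd a)) = U (.ofAdd (l * a))) (a : L) :
    IsNilpotent (U (.ofAdd a) - 1) := by
  refine isNilpotent_of_forall_algHom_algebraicClosure (K := K) fun ψ => ?_
  have : Infinite Lˣ := by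
    rw [← not_finite_iff_infinite]
    intro h
    have : Finite {x : L // x ≠ 0} := Finite.of_equiv _ unitsEquivNeZero
    have : ({0}ᶜ : Set L).Finite := this
    exact (Set.finite_singleton (0 : L)).infinite_compl this
  -- Pigeonhole: `B` has only finitely many characters.
  obtain ⟨l, m, hlm, heq⟩ := Finite.exists_ne_map_eq_of_infinite fun l => ψ.comp (c l)
  have key (x : L) : ψ (U (.ofAdd (l * x))) = ψ (U (.ofAdd (m * x))) := by
    rw [← hc, ← hc]
    exact DFunLike.congr_fun heq _
  have hne : (l : L) - m ≠ 0 := sub_ne_zero.2 fun h => hlm (Units.ext h)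
  obtain ⟨x, rfl⟩ : ∃ x, ((l : L) - m) * x = a := ⟨a / (l - m), mul_div_cancel₀ a hne⟩
  have hsplit : U (.ofAdd (l * x)) = U (.ofAdd (m * x)) * U (.ofAdd ((l - m) * x)) := by
    rw [← map_mul, ← ofAdd_add]
    congr 2
    ring
  have hunit : IsUnit (ψ (U (.ofAdd (m * x)))) :=
    ((Group.isUnit (Multiplicative.ofAdd ((m : L) * x))).map U).map ψ
  have h := key x
  rw [hsplit, map_mul] at h
  rw [map_sub, map_one, sub_eq_zero]
  exact hunit.mul_left_cancel (by rw [h, mul_one])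

/-- A unipotent element whose order is finite and invertible is trivial. -/
theorem eq_one_of_pow_eq_one_of_isNilpotent_sub_one {B : Type*} [CommRing B] {u : B} {n : ℕ}
    (hn : IsUnit (n : B)) (hu : IsNilpotent (u - 1)) (hpow : u ^ n = 1) : u = 1 := by
  have hgeom := mul_geom_sum u n
  rw [hpow, sub_self] at hgeom
  -- Modulo nilpotents the geometric sum is `n`, hence it is a unit; it annihilates `u - 1`.
  have hnil : IsNilpotent ((∑ i ∈ Finset.range n, u ^ i) - n) := by
    have : (∑ i ∈ Finset.range n, u ^ i) - n = ∑ i ∈ Finset.range n, (u ^ i - 1) := by simp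
    rw [this]
    exact (Ideal.sum_mem (nilradical B) fun i _ =>
      Ideal.mem_of_dvd _ (sub_one_dvd_pow_sub_one u i) hu)
  have hunit : IsUnit (∑ i ∈ Finset.range n, u ^ i) := by
    have := hnil.isUnit_add_left_of_commute hn (Commute.all _ _)
    simpa using this
  exact sub_eq_zero.1 ((hunit.mul_left_eq_zero).1 hgeom)

/-- In different characteristics, a unipotent representation of the additive group of a field is
trivial. -/
theorem eq_one_of_forall_isNilpotent_sub_one {K L B : Type*} [Field K] [Field L] [CommRing B]
    [Algebra K B] [FiniteDimensional K B] (hchar : ringChar L ≠ ringChar K)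
    (U : Multiplicative L →* B) (hU : ∀ a, IsNilpotent (U (.ofAdd a) - 1)) (a : L) :
    U (.ofAdd a) = 1 := by
  nontriviality B
  by_cases hp : ringChar L = 0
  · have : CharP L 0 := hp ▸ ringChar.charP L
    have : CharZero L := CharP.charP_to_charZero L
    have hq : ringChar K ≠ 0 := fun h => hchar (hp.trans h.symm)
    have : Fact (ringChar K).Prime := ⟨(CharP.char_is_prime_or_zero K _).resolve_right hq⟩
    have : CharP B (ringChar K) := charP_of_injective_algebraMap (algebraMap K B).injective _
    have : IsArtinianRing B := IsArtinianRing.of_finite K B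
    obtain ⟨N, hN⟩ := IsArtinianRing.isNilpotent_nilradical (R := B)
    have hle : N ≤ ringChar K ^ N := (Nat.lt_pow_self (Fact.out : (ringChar K).Prime).one_lt).le
    have hL : ((ringChar K ^ N : ℕ) : L) ≠ 0 := Nat.cast_ne_zero.2 (pow_ne_zero N hq)
    -- With `q = ringChar K`, `U a` is the `q ^ N`-th power of `U b`, and Frobenius turns `(U b - 1)
    -- ^ (q ^ N) = 0` into `U a = 1`.
    obtain ⟨b, rfl⟩ : ∃ b, ((ringChar K ^ N : ℕ) : L) * b = a :=
      ⟨a / (ringChar K ^ N : ℕ), mul_div_cancel₀ a hL⟩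
    have hzero : (U (.ofAdd b) - 1) ^ N = 0 := by
      have := Ideal.pow_mem_pow (mem_nilradical.2 (hU b)) N
      rwa [hN] at this
    have hpow := pow_eq_zero_of_le hle hzero
    rw [sub_pow_char_pow, one_pow, sub_eq_zero] at hpow
    rw [← nsmul_eq_mul, ofAdd_nsmul, map_pow, hpow]
  · have hprime : (ringChar L).Prime := (CharP.char_is_prime_or_zero L _).resolve_right hp
    have hK : ((ringChar L : ℕ) : K) ≠ 0 := fun h =>
      (hprime.eq_one_or_self_of_dvd _ (ringChar.dvd h)).elim (CharP.ringChar_ne_one)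
        (hchar ∘ Eq.symm)
    refine eq_one_of_pow_eq_one_of_isNilpotent_sub_one (n := ringChar L) ?_ (hU a) ?_
    · simpa using (IsUnit.mk0 _ hK).map (algebraMap K B)
    · rw [← map_pow, ← ofAdd_nsmul, nsmul_eq_mul, ringChar.Nat.cast_ringChar, zero_mul,
        ofAdd_zero, map_one]

/-- A finite-dimensional representation over `K` of the additive group of an infinite field `L` of
another characteristic is trivial if it is isomorphic to its twists by the scalings of `L`. -/
theorem end_eq_one_of_scaling {K L V : Type*} [Field K] [Field L] [Infinite L]
    [AddCommGroup V] [Module K V] [FiniteDimensional K V] (hchar : ringChar L ≠ ringChar K)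
    (U : Multiplicative L →* Module.End K V) (D : Lˣ → (Module.End K V)ˣ)
    (hD : ∀ l a, D l * U (.ofAdd a) = U (.ofAdd (l * a)) * D l) (a : L) :
    U (.ofAdd a) = 1 := by
  let B : Subalgebra K (Module.End K V) := Algebra.adjoin K (Set.range U)
  have hcomm : ∀ f ∈ Set.range U, ∀ g ∈ Set.range U, f * g = g * f := by
    rintro _ ⟨x, rfl⟩ _ ⟨y, rfl⟩
    rw [← map_mul, mul_comm, map_mul]
  have : IsMulCommutative B := Algebra.isMulCommutative_adjoin K hcomm
  let : CommRing B := IsMulCommutative.instCommRing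
  let U' : Multiplicative L →* B :=
    U.codRestrict B fun x => Algebra.subset_adjoin ⟨x, rfl⟩
  let conj (l : Lˣ) : Module.End K V →ₐ[K] Module.End K V :=
    MulSemiringAction.toAlgHom K (Module.End K V) (ConjAct.toConjAct (D l))
  have hconj (l : Lˣ) (x : L) : conj l (U (.ofAdd x)) = U (.ofAdd (l * x)) := by
    change (D l : Module.End K V) * U (.ofAdd x) * ((D l)⁻¹ : (Module.End K V)ˣ) = _
    rw [hD, Units.mul_inv_cancel_right]
  have hB (l : Lˣ) (b : B) : conj l b ∈ B := by
    have : B ≤ B.comap (conj l) := by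
      refine Algebra.adjoin_le ?_
      rintro _ ⟨x, rfl⟩
      exact Algebra.subset_adjoin ⟨.ofAdd (l * x.toAdd), (hconj l x.toAdd).symm⟩
    exact this b.2
  let c (l : Lˣ) : B →ₐ[K] B := ((conj l).comp B.val).codRestrict B (hB l)
  have hc (l : Lˣ) (x : L) : c l (U' (.ofAdd x)) = U' (.ofAdd (l * x)) := Subtype.ext (hconj l x)
  have hnil := isNilpotent_sub_one_of_scaling (K := K) (B := B) U' c hc
  have h := eq_one_of_forall_isNilpotent_sub_one (K := K) (B := B) hchar U' hnil a
  exact congrArg Subtype.val h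

section

variable {L : Type*} [Field L] {A : Type u} [Category.{v} A] [Preadditive A]
  [HasBinaryBiproducts A] [Linear L A]

/-- The transvection `(s, t) ↦ (s, t + a • s)` of `x ⊞ x`. -/
noncomputable def biprodTransvection (x : A) (a : L) : x ⊞ x ⟶ x ⊞ x :=
  𝟙 _ + a • (biprod.fst ≫ biprod.inr)

theorem biprodTransvection_zero (x : A) : biprodTransvection x (0 : L) = 𝟙 _ := by
  simp [biprodTransvection]

theorem biprodTransvection_comp (x : A) (a b : L) :
    biprodTransvection x a ≫ biprodTransvection x b = biprodTransvection x (a + b) := by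
  simp [biprodTransvection, add_smul]
  abel

theorem inl_biprodTransvection_snd (x : A) (a : L) :
    biprod.inl ≫ biprodTransvection x a ≫ biprod.snd = a • 𝟙 x := by
  simp [biprodTransvection]

/-- The automorphism `(s, t) ↦ (s, l • t)` of `x ⊞ x`. -/
noncomputable def biprodScaling (x : A) (l : Lˣ) : x ⊞ x ≅ x ⊞ x where
  hom := biprod.map (𝟙 x) ((l : L) • 𝟙 x)
  inv := biprod.map (𝟙 x) ((↑l⁻¹ : L) • 𝟙 x)
  hom_inv_id := by ext <;> simp [smul_smul]
  inv_hom_id := by ext <;> simp [smul_smul]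

theorem biprodTransvection_scaling (x : A) (l : Lˣ) (a : L) :
    biprodTransvection x a ≫ (biprodScaling x l).hom =
      (biprodScaling x l).hom ≫ biprodTransvection x (l * a) := by
  ext <;> simp [biprodTransvection, biprodScaling, smul_smul, mul_comm]

theorem map_biprodTransvection [Infinite L] {K : Type k} [Field K]
    (hchar : ringChar L ≠ ringChar K) (F : A ⥤ ModuleCat.{w} K) (hF : finDimValued A K F)
    (x : A) (a : L) : F.map (biprodTransvection x a) = 𝟙 _ := by
  have := hF (x ⊞ x)
  let U : Multiplicative L →* Module.End K (F.obj (x ⊞ x)) :=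
    { toFun := fun a => (F.map (biprodTransvection x a.toAdd)).hom
      map_one' := by simp [biprodTransvection_zero, Module.End.one_eq_id]
      map_mul' := fun a b => by
        rw [mul_comm, toAdd_mul, ← biprodTransvection_comp, F.map_comp]
        rfl }
  let D (l : Lˣ) : (Module.End K (F.obj (x ⊞ x)))ˣ :=
    LinearMap.GeneralLinearGroup.ofLinearEquiv (F.mapIso (biprodScaling x l)).toLinearEquiv
  refine ModuleCat.hom_ext (end_eq_one_of_scaling hchar U D (fun l b => ?_) a)
  have h := congrArg F.map (biprodTransvection_scaling x l b)
  rw [F.map_comp, F.map_comp] at h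
  exact congrArg ModuleCat.Hom.hom h

/-- Since `a • 𝟙 x` factors through a transvection, which `F` trivializes, its image does not depend
on `a`; compare `a = 0` and `a = 1`. -/
theorem map_zero_eq_id [Infinite L] {K : Type k} [Field K]
    (hchar : ringChar L ≠ ringChar K) (F : A ⥤ ModuleCat.{w} K) (hF : finDimValued A K F)
    (x : A) : F.map (0 : x ⟶ x) = 𝟙 _ := by
  have key (a : L) : F.map (a • 𝟙 x) = F.map (biprod.inl : x ⟶ x ⊞ x) ≫ F.map biprod.snd := by
    rw [← inl_biprodTransvection_snd, F.map_comp, F.map_comp,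
      map_biprodTransvection hchar F hF, Category.id_comp]
  have h := (key 0).trans (key 1).symm
  rwa [zero_smul, one_smul, F.map_id] at h

end

open ZeroObject in
theorem mainTheorem11
    (L : Type*) [Field L] [Infinite L]
    (K : Type k) [Field K]
    (hchar : ringChar L ≠ ringChar K)
    (A : Type u) [Category.{v} A] [Preadditive A] [HasFiniteBiproducts A] [Linear L A]
    (F : A ⥤ ModuleCat.{w} K) :
    finDimValued A K F ↔
      ∃ V : ModuleCat.{w} K, FiniteDimensional K V ∧ IsConstantWithValue F V := by
  constructor
  · intro hF
    have : HasBinaryBiproducts A := hasBinaryBiproducts_of_finite_biproducts A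
    have : HasZeroObject A := hasZeroObject_of_hasFiniteBiproducts A
    refine ⟨F.obj 0, hF 0, ⟨NatIso.ofComponents (fun x =>
      { hom := F.map 0
        inv := F.map 0
        hom_inv_id := ?_
        inv_hom_id := ?_ }) ?_⟩⟩
    · rw [← F.map_comp, comp_zero, map_zero_eq_id hchar F hF]
    · rw [← F.map_comp, comp_zero, map_zero_eq_id hchar F hF]
      rfl
    · intro x y f
      simp [← F.map_comp]
  · rintro ⟨V, hV, ⟨e⟩⟩ x
    have e' : F.obj x ≅ V := e.app x
    exact e'.toLinearEquiv.symm.finiteDimensional
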